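/- Let $d\ge 1$, $a>0$, and let $X,X_1,X_2,\ldots$ be i.i.d. $\mathbb{R}^d$-valued random vectors on a probability space. Assume that the law of $X$ is absolutely continuous with respect to Lebesgue measure, that $\mathbb{E}\|X\|^4<\infty$, $\mathbb{E}[X]=0$, $\mathbb{E}[XX^\top]=\mathrm{I}_d$, and that there is no $\mu\in\mathbb{R}^d$ such that $X-\mu$ and $\mu-X$ have the same distribution. For $s,t\in\mathbb{R}^d$ put $$\mathrm{R}(t)=\mathbb{E}[\cos(t^\top X)],\quad \mathrm{I}(t)=\mathbb{E}[\sin(t^\top X)],\quad \mathrm{C}(t)=\mathbb{E}[X\cos(t^\top X)],\quad \mathrm{S}(t)=\mathbb{E}[X\sin(t^\top X)],$$ \begin{align*} K(s,t)={}&\mathbb{E}[\sin(s^\top X)\sin(t^\top X)]-\mathrm{I}(s)\mathrm{I}(t)-\mathrm{R}(t)\,t^\top\mathrm{S}(s)-\mathrm{R}(s)\,s^\top\mathrm{S}(t)+\mathrm{R}(s)\mathrm{R}(t)\,s^\top t\\ &-\tfrac12 t^\top\mathbb{E}[\sin(s^\top X)XX^\top]\mathrm{C}(t)+\tfrac12\mathrm{I}(s)\,t^\top\mathrm{C}(t)-\tfrac12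 s^\top\mathbb{E}[\sin(t^\top X)XX^\top]\mathrm{C}(s)+\tfrac12\mathrm{I}(t)\,s^\top\mathrm{C}(s)\\ &+\tfrac12\mathrm{R}(s)\,s^\top\mathbb{E}[X\,t^\top X\,X^\top]\mathrm{C}(t)+\tfrac12\mathrm{R}(t)\,t^\top\mathbb{E}[X\,s^\top X\,X^\top]\mathrm{C}(s)\\ &+\tfrac14\left\{\mathrm{C}(s)^\top\mathbb{E}[XX^\top s\,t^\top XX^\top]\mathrm{C}(t)-s^\top\mathrm{C}(s)\,t^\top\mathrm{C}(t)\right\}, \end{align*} $$\sigma^2=4\int_{\mathbb{R}^d}\int_{\mathbb{R}^d}K(s,t)\,\mathrm{I}(s)\mathrm{I}(t)\,e^{-a(\|s\|^2+\|t\|^2)}\,\mathrm{d}s\,\mathrm{d}t .$$ For a sample $X_1,\ldots,X_n$ let $\overline{X}_n=n^{-1}\sum_{j=1}^n X_j$, $S_n=n^{-1}\sum_{j=1}^n(X_j-\overline{X}_n)(X_j-\overline{X}_n)^\top$, and let $Y_{n,j}=S_n^{-1/2}(X_j-\overline{X}_n)$, $1\le j\le n$, be the scaled residuals, where $S_n^{-1/2}$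 is the symmetric positive semidefinite square root of $S_n^{-1}$ (for $n\ge d+1$ the matrix $S_n$ is almost surely invertible). Let $\widehat{\sigma}_n^2$ be obtained from the formula for $\sigma^2$ by replacing each of the expectations above, including those in $\mathrm{R},\mathrm{I},\mathrm{C},\mathrm{S}$, by the corresponding average over $Y_{n,1},\ldots,Y_{n,n}$; for example, $\mathrm{I}(t)$ is replaced by $n^{-1}\sum_{j=1}^n\sin(t^\top Y_{n,j})$ and $\mathbb{E}[\sin(s^\top X)\sin(t^\top X)]$ by $n^{-1}\sum_{j=1}^n\sin(s^\top Y_{n,j})\sin(t^\top Y_{n,j})$. Then $$\widehat{\sigma}_n^2\ \overset{\mathbb{P}}{\longrightarrow}\ \sigma^2\qquad(n\to\infty).$$ -/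

import Mathlib

open MeasureTheory ProbabilityTheory Filter Matrix
open scoped ENNReal

namespace ReflectedSymmetry

noncomputable section

/-! ### Functionals of a distribution

Throughout, `ν` is a distribution on `ℝ^d`, the law of a random vector `X`, so that `∫ x, f x ∂ν`
is the expectation `E[f(X)]`.  The same functionals are evaluated below at the empirical
distribution of the scaled residuals. -/

/-- `R(t) = E[cos(tᵀX)]`. -/
def reCF {d : ℕ} (ν : Measure (EuclideanSpace ℝ (Fin d))) (t : EuclideanSpace ℝ (Fin d)) : ℝ :=
  ∫ x, Real.cos (inner ℝ t x) ∂ν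

/-- `I(t) = E[sin(tᵀX)]`. -/
def imCF {d : ℕ} (ν : Measure (EuclideanSpace ℝ (Fin d))) (t : EuclideanSpace ℝ (Fin d)) : ℝ :=
  ∫ x, Real.sin (inner ℝ t x) ∂ν

/-- `C(t) = E[X cos(tᵀX)]`. -/
def cosVec {d : ℕ} (ν : Measure (EuclideanSpace ℝ (Fin d))) (t : EuclideanSpace ℝ (Fin d)) :
    EuclideanSpace ℝ (Fin d) :=
  ∫ x, Real.cos (inner ℝ t x) • x ∂ν

/-- `S(t) = E[X sin(tᵀX)]`. -/
def sinVec {d : ℕ} (ν : Measure (EuclideanSpace ℝ (Fin d))) (t : EuclideanSpace ℝ (Fin d)) :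
    EuclideanSpace ℝ (Fin d) :=
  ∫ x, Real.sin (inner ℝ t x) • x ∂ν

/-- `E[sin(sᵀX) sin(tᵀX)]`. -/
def sinSin {d : ℕ} (ν : Measure (EuclideanSpace ℝ (Fin d))) (s t : EuclideanSpace ℝ (Fin d)) : ℝ :=
  ∫ x, Real.sin (inner ℝ s x) * Real.sin (inner ℝ t x) ∂ν

/-- The matrix `E[sin(sᵀX) X Xᵀ]`. -/
def sinMat {d : ℕ} (ν : Measure (EuclideanSpace ℝ (Fin d))) (s : EuclideanSpace ℝ (Fin d)) :
    Matrix (Fin d) (Fin d) ℝ :=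
  Matrix.of fun i j => ∫ x, Real.sin (inner ℝ s x) * (x i * x j) ∂ν

/-- The matrix `E[X tᵀX Xᵀ]`. -/
def thirdMat {d : ℕ} (ν : Measure (EuclideanSpace ℝ (Fin d))) (t : EuclideanSpace ℝ (Fin d)) :
    Matrix (Fin d) (Fin d) ℝ :=
  Matrix.of fun i j => ∫ x, x i * inner ℝ t x * x j ∂ν

/-- The matrix `E[X Xᵀs tᵀX Xᵀ]`. -/
def fourthMat {d : ℕ} (ν : Measure (EuclideanSpace ℝ (Fin d))) (s t : EuclideanSpace ℝ (Fin d)) :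
    Matrix (Fin d) (Fin d) ℝ :=
  Matrix.of fun i j => ∫ x, x i * inner ℝ x s * inner ℝ t x * x j ∂ν

/-- The bilinear form `uᵀ M v`. -/
def bil {d : ℕ} (u : EuclideanSpace ℝ (Fin d)) (M : Matrix (Fin d) (Fin d) ℝ)
    (v : EuclideanSpace ℝ (Fin d)) : ℝ :=
  u.ofLp ⬝ᵥ (M *ᵥ v.ofLp)

/-- The covariance kernel `K(s,t)`. -/
def covKernel {d : ℕ} (ν : Measure (EuclideanSpace ℝ (Fin d)))
    (s t : EuclideanSpace ℝ (Fin d)) : ℝ :=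
  sinSin ν s t - imCF ν s * imCF ν t
    - reCF ν t * inner ℝ t (sinVec ν s) - reCF ν s * inner ℝ s (sinVec ν t)
    + reCF ν s * reCF ν t * inner ℝ s t
    - 1 / 2 * bil t (sinMat ν s) (cosVec ν t) + 1 / 2 * imCF ν s * inner ℝ t (cosVec ν t)
    - 1 / 2 * bil s (sinMat ν t) (cosVec ν s) + 1 / 2 * imCF ν t * inner ℝ s (cosVec ν s)
    + 1 / 2 * reCF ν s * bil s (thirdMat ν t) (cosVec ν t)
    + 1 / 2 * reCF ν t * bil t (thirdMat ν s) (cosVec ν s)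
    + 1 / 4 * (bil (cosVec ν s) (fourthMat ν s t) (cosVec ν t)
        - inner ℝ s (cosVec ν s) * inner ℝ t (cosVec ν t))

/-- `σ² = 4 ∫∫ K(s,t) I(s) I(t) exp(-a(‖s‖² + ‖t‖²)) ds dt`. -/
def sigmaSq {d : ℕ} (a : ℝ) (ν : Measure (EuclideanSpace ℝ (Fin d))) : ℝ :=
  4 * ∫ s : EuclideanSpace ℝ (Fin d), ∫ t : EuclideanSpace ℝ (Fin d),
    covKernel ν s t * imCF ν s * imCF ν t * Real.exp (-a * (‖s‖ ^ 2 + ‖t‖ ^ 2))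

/-! ### Sample quantities -/

/-- The sample mean `n⁻¹ ∑ xⱼ`. -/
def sampleMean {d n : ℕ} (x : Fin n → EuclideanSpace ℝ (Fin d)) : EuclideanSpace ℝ (Fin d) :=
  (n : ℝ)⁻¹ • ∑ j, x j

/-- The sample covariance matrix `n⁻¹ ∑ (xⱼ - x̄)(xⱼ - x̄)ᵀ`. -/
def sampleCov {d n : ℕ} (x : Fin n → EuclideanSpace ℝ (Fin d)) : Matrix (Fin d) (Fin d) ℝ :=
  (n : ℝ)⁻¹ • ∑ j, vecMulVec (x j - sampleMean x).ofLp (x j - sampleMean x).ofLp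

open scoped MatrixOrder in
/-- The scaled residuals `yⱼ = S^{-1/2} (xⱼ - x̄)`, where `S^{-1/2}` is the symmetric positive
semidefinite square root of the inverse of the sample covariance matrix `S`. -/
def scaledResidual {d n : ℕ} (x : Fin n → EuclideanSpace ℝ (Fin d)) (j : Fin n) :
    EuclideanSpace ℝ (Fin d) :=
  WithLp.toLp 2 (CFC.sqrt (sampleCov x)⁻¹ *ᵥ (x j - sampleMean x).ofLp)

/-- The empirical distribution `n⁻¹ ∑ δ_{yⱼ}`. -/
def empirical {d n : ℕ} (y : Fin n → EuclideanSpace ℝ (Fin d)) :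
    Measure (EuclideanSpace ℝ (Fin d)) :=
  (n : ℝ≥0∞)⁻¹ • ∑ j, Measure.dirac (y j)

/-- Expectations under the empirical distribution are the averages `n⁻¹ ∑ f(yⱼ)`. -/
theorem integral_empirical {d n : ℕ} {F : Type*} [NormedAddCommGroup F] [NormedSpace ℝ F]
    [CompleteSpace F] (y : Fin n → EuclideanSpace ℝ (Fin d)) (f : EuclideanSpace ℝ (Fin d) → F) :
    ∫ x, f x ∂(empirical y) = (n : ℝ)⁻¹ • ∑ j, f (y j) := by
  rw [empirical, integral_smul_measure, integral_finsetSum_measure]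
  · simp
  · intro i _
    exact integrable_dirac (by simp)

/-- The estimator
`σ̂ₙ² = 4 ∫∫ Kₙ(s,t) Iₙ(s) Iₙ(t) exp(-a(‖s‖² + ‖t‖²)) ds dt`, in which every expectation in the
definition of `σ²` is replaced with the average over the scaled residuals. -/
def sigmaSqHat {d n : ℕ} (a : ℝ) (x : Fin n → EuclideanSpace ℝ (Fin d)) : ℝ :=
  sigmaSq a (empirical (scaledResidual x))

/-- The hypothesis of reflected symmetry: `X - μ` and `μ - X` have the same law for some `μ`. -/
def IsReflectedSymmetric {d : ℕ} (ν : Measure (EuclideanSpace ℝ (Fin d))) : Prop :=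
  ∃ μ : EuclideanSpace ℝ (Fin d), ν.map (fun x => x - μ) = ν.map (fun x => μ - x)

end

end ReflectedSymmetry

/-!
The estimator converges almost surely, hence in probability, because it is a continuous function of
averages over the residuals to which a uniform law of large numbers applies.

The residuals are `B (Xⱼ - m)`, where `m` is the sample mean and `B` the inverse square root of the
sample covariance matrix. By the strong law of large numbers `m → 0` and the sample covariance
matrix tends to the identity, so that `B → 1` by continuity of the square root on positive
semidefinite matrices (`continuousOn_sqrt_posSemidef`). Every expectation that enters `sigmaSq` has
the form `E[h(p, X)]` with `p` one or both of the arguments `s`, `t`, and `h` continuous and growing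
at most like `‖x‖⁴` in `x`. Viewing `(p, B, m)` as a single parameter `θ`, the residual averages
are averages of `g θₙ Xⱼ = h(p, Bₙ (Xⱼ - mₙ))` along `θₙ → (p, 1, 0)`. For `θ` in a compact set `Θ`
these converge almost surely uniformly in `θ`: this is the strong law for the random elements
`g · Xⱼ` of the Banach space `C(Θ, F)` (`ae_tendsto_average_param_of_compact`). Hence almost surely,
for all `s` and `t` at once, the empirical kernel converges to the kernel
(`ae_tendsto_integral_empirical_scaledResidual`, `tendsto_covKernel`).

Since the kernel is bounded by a polynomial in `‖s‖`, `‖t‖` and the fourth moment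
(`abs_covKernel_le`), and the fourth moments of the residuals converge, the Gaussian weight dominates
the integrands and the integrals converge (`tendsto_sigmaSq`). The passage to convergence in
probability needs the estimator to be a measurable function of the sample; for this the empirical
distribution is regarded as a finite kernel from samples to distributions (`measurable_sigmaSqHat`).
-/

namespace ReflectedSymmetry

open scoped Topology

/-! ### The symmetric square root and the scaled residuals -/

open scoped MatrixOrder Matrix.Norms.L2Operator in
theorem continuousOn_sqrt_posSemidef {d : ℕ} :
    ContinuousOn (fun M : Matrix (Fin d) (Fin d) ℝ => CFC.sqrt M) {M | M.PosSemidef} := by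
  have := CFC.continuousOn_sqrt (A := Matrix (Fin d) (Fin d) ℝ)
  simpa only [Matrix.nonneg_iff_posSemidef] using this

theorem posSemidef_sampleCov {d n : ℕ} (x : Fin n → EuclideanSpace ℝ (Fin d)) :
    (sampleCov x).PosSemidef := by
  refine PosSemidef.smul (posSemidef_sum _ fun j _ => ?_) (by positivity)
  simpa using posSemidef_vecMulVec_self_star (x j - sampleMean x).ofLp

theorem continuous_sampleMean {d n : ℕ} :
    Continuous (sampleMean : (Fin n → EuclideanSpace ℝ (Fin d)) → _) := by
  unfold sampleMean
  fun_prop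

theorem continuous_sampleCov {d n : ℕ} :
    Continuous (sampleCov : (Fin n → EuclideanSpace ℝ (Fin d)) → _) := by
  have h := continuous_sampleMean (d := d) (n := n)
  refine continuous_matrix fun i j => ?_
  simp only [sampleCov, Matrix.smul_apply, Matrix.sum_apply, vecMulVec_apply]
  fun_prop

open scoped MatrixOrder in
theorem measurable_sqrt_inv_sampleCov {d n : ℕ} (i j : Fin d) :
    Measurable fun x : Fin n → EuclideanSpace ℝ (Fin d) => CFC.sqrt (sampleCov x)⁻¹ i j := by
  borelize (Matrix (Fin d) (Fin d) ℝ)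
  have : SecondCountableTopology (Matrix (Fin d) (Fin d) ℝ) :=
    inferInstanceAs (SecondCountableTopology (Fin d → Fin d → ℝ))
  have hS := continuous_sampleCov (d := d) (n := n)
  -- `Matrix.inv_def` holds for singular matrices too, so the junk value `0` needs no separate case.
  have hinv : Measurable fun x : Fin n → EuclideanSpace ℝ (Fin d) => (sampleCov x)⁻¹ := by
    simp only [Matrix.inv_def, Ring.inverse_eq_inv']
    exact ((hS.matrix_det.measurable.inv).stronglyMeasurable.smul
      hS.matrix_adjugate.stronglyMeasurable).measurable
  -- The square root is continuous only on positive semidefinite matrices, where `S⁻¹` takes values.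
  have hsub : Measurable fun x : Fin n → EuclideanSpace ℝ (Fin d) =>
      (⟨(sampleCov x)⁻¹, (posSemidef_sampleCov x).inv⟩ :
        {M : Matrix (Fin d) (Fin d) ℝ | M.PosSemidef}) := hinv.subtype_mk
  exact ((continuousOn_iff_continuous_domRestrict.1 continuousOn_sqrt_posSemidef).matrix_elem
    i j).measurable.comp hsub

theorem measurable_scaledResidual {d n : ℕ} (j : Fin n) :
    Measurable fun x : Fin n → EuclideanSpace ℝ (Fin d) => scaledResidual x j := by
  refine (WithLp.measurable_toLp 2 _).comp (measurable_pi_lambda _ fun i => ?_)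
  simp only [mulVec, dotProduct]
  refine Finset.measurable_sum _ fun k _ => (measurable_sqrt_inv_sampleCov i k).mul ?_
  have h := continuous_sampleMean (d := d) (n := n)
  exact Continuous.measurable (by fun_prop)

/-- The sample covariance matrix is the difference of the second moment and the square of the
sample mean. -/
theorem sampleCov_apply {d n : ℕ} (x : Fin n → EuclideanSpace ℝ (Fin d)) (i j : Fin d) :
    sampleCov x i j =
      (n : ℝ)⁻¹ * ∑ k, x k i * x k j - sampleMean x i * sampleMean x j := by
  have hm (i : Fin d) : sampleMean x i = (n : ℝ)⁻¹ * ∑ k, x k i := by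
    simp [sampleMean]
  simp only [sampleCov, Matrix.smul_apply, Matrix.sum_apply, vecMulVec_apply, smul_eq_mul,
    WithLp.ofLp_sub, Pi.sub_apply, sub_mul, mul_sub, Finset.sum_sub_distrib, ← Finset.mul_sum,
    ← Finset.sum_mul, Finset.sum_const, Finset.card_univ, Fintype.card_fin, nsmul_eq_mul]
  rcases eq_or_ne n 0 with rfl | hn
  · simp [hm]
  · rw [hm i, hm j]
    field_simp
    ring

open scoped MatrixOrder in
theorem tendsto_sqrt_inv {d : ℕ} {S : ℕ → Matrix (Fin d) (Fin d) ℝ} (hS : ∀ n, (S n).PosSemidef)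
    (h : Tendsto S atTop (𝓝 1)) : Tendsto (fun n => CFC.sqrt (S n)⁻¹) atTop (𝓝 1) := by
  have hinv : Tendsto (fun n => (S n)⁻¹) atTop (𝓝 1) := by
    have : ContinuousAt (Inv.inv : Matrix (Fin d) (Fin d) ℝ → _) 1 := by
      refine continuousAt_matrix_inv _ ?_
      simp only [det_one, Ring.inverse_eq_inv']
      exact continuousAt_inv₀ one_ne_zero
    simpa [Function.comp_def] using this.tendsto.comp h
  have h1 := continuousOn_sqrt_posSemidef.continuousWithinAt (PosSemidef.one (n := Fin d) (R := ℝ))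
  have := h1.tendsto.comp
    (tendsto_nhdsWithin_iff.2 ⟨hinv, Eventually.of_forall fun n => (hS n).inv⟩)
  rwa [CFC.sqrt_one] at this

/-! ### A uniform law of large numbers -/

/-- A uniform law of large numbers over a compact parameter space, obtained from the strong law for
the `C(Θ, F)`-valued random elements `θ ↦ g θ (X j)`. -/
theorem ae_tendsto_average_param_of_compact {Ω E F Θ : Type*} [MeasurableSpace Ω] {P : Measure Ω}
    [NormedAddCommGroup E] [MeasurableSpace E] [BorelSpace E] [SecondCountableTopology E]
    [NormedAddCommGroup F] [NormedSpace ℝ F] [CompleteSpace F]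
    [TopologicalSpace Θ] [CompactSpace Θ]
    {ν : Measure E} {X : ℕ → Ω → E}
    (hlaw : ∀ j, HasLaw (X j) ν P) (hindep : iIndepFun X P)
    {g : Θ → E → F} (hg : Continuous (Function.uncurry g))
    {b : E → ℝ} (hb : Integrable b ν) (hgb : ∀ θ x, ‖g θ x‖ ≤ b x) :
    ∀ᵐ ω ∂P, ∀ (θ : ℕ → Θ) (θ₀ : Θ), Tendsto θ atTop (𝓝 θ₀) →
      Tendsto (fun n : ℕ => (n : ℝ)⁻¹ • ∑ j ∈ Finset.range n, g (θ n) (X j ω)) atTop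
        (𝓝 (∫ x, g θ₀ x ∂ν)) := by
  rcases isEmpty_or_nonempty Θ with hΘ | ⟨⟨θ'⟩⟩
  · exact Eventually.of_forall fun _ θ => (hΘ.false (θ 0)).elim
  borelize C(Θ, F)
  let G : C(E, C(Θ, F)) :=
    ContinuousMap.curry ⟨fun p => g p.2 p.1, hg.comp continuous_swap⟩
  have hGint : Integrable G ν :=
    hb.mono' G.continuous.aestronglyMeasurable <| Eventually.of_forall fun x =>
      (ContinuousMap.norm_le _ ((norm_nonneg _).trans (hgb θ' x))).2 fun θ => hgb θ x
  have hGm : Measurable G := G.continuous.measurable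
  have hX0 : Integrable (fun ω => G (X 0 ω)) P :=
    (hlaw 0).map_eq ▸ hGint |>.comp_aemeasurable (hlaw 0).aemeasurable
  have hval : ∫ ω, G (X 0 ω) ∂P = ∫ x, G x ∂ν :=
    (hlaw 0).integral_comp G.continuous.aestronglyMeasurable
  have hslln := strong_law_ae (fun j ω => G (X j ω)) hX0
    (fun i j hij => (hindep.indepFun hij).comp hGm hGm)
    (fun i => ((hlaw i).identDistrib (hlaw 0)).comp hGm)
  filter_upwards [hslln] with ω hω θ θ₀ hθ
  rw [hval] at hω
  -- Evaluation `(f, θ) ↦ f θ` is jointly continuous, so the parameter may move with `n`.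
  have h1 := (continuous_eval (F := C(Θ, F))).tendsto (∫ x, G x ∂ν, θ₀) |>.comp
    (hω.prodMk_nhds hθ)
  have h2 : (∫ x, G x ∂ν) θ₀ = ∫ x, g θ₀ x ∂ν :=
    ((ContinuousMap.evalCLM ℝ θ₀).integral_comp_comm hGint).symm
  rw [← h2]
  refine h1.congr fun n => ?_
  simp [G]
  rfl

/-- A uniform law of large numbers: almost surely, averages of `g (θ n) (X j)` over `j < n` converge
to the expectation of `g θ₀` along every parameter sequence `θ n → θ₀`. -/
theorem ae_tendsto_average_param {Ω E F Θ : Type*} [MeasurableSpace Ω] {P : Measure Ω}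
    [NormedAddCommGroup E] [MeasurableSpace E] [BorelSpace E] [SecondCountableTopology E]
    [NormedAddCommGroup F] [NormedSpace ℝ F] [CompleteSpace F]
    [NormedAddCommGroup Θ] [ProperSpace Θ]
    {ν : Measure E} {X : ℕ → Ω → E}
    (hlaw : ∀ j, HasLaw (X j) ν P) (hindep : iIndepFun X P)
    {g : Θ → E → F} (hg : Continuous (Function.uncurry g))
    {b : ℕ → E → ℝ} (hb : ∀ N, Integrable (b N) ν)
    (hgb : ∀ (N : ℕ) θ x, ‖θ‖ ≤ N → ‖g θ x‖ ≤ b N x) :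
    ∀ᵐ ω ∂P, ∀ (θ : ℕ → Θ) (θ₀ : Θ), Tendsto θ atTop (𝓝 θ₀) →
      Tendsto (fun n : ℕ => (n : ℝ)⁻¹ • ∑ j ∈ Finset.range n, g (θ n) (X j ω)) atTop
        (𝓝 (∫ x, g θ₀ x ∂ν)) := by
  have key (N : ℕ) := by
    have : CompactSpace (Metric.closedBall (0 : Θ) N) :=
      isCompact_iff_compactSpace.1 (isCompact_closedBall _ _)
    exact ae_tendsto_average_param_of_compact hlaw hindep
      (Θ := Metric.closedBall (0 : Θ) N) (g := fun θ x => g θ x)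
      (hg.comp (by fun_prop :
        Continuous fun p : Metric.closedBall (0 : Θ) N × E => ((p.1 : Θ), p.2)))
      (hb N) (fun θ x => hgb N θ x (mem_closedBall_zero_iff.1 θ.2))
  filter_upwards [ae_all_iff.2 key] with ω hω θ θ₀ hθ
  obtain ⟨R, hR⟩ := (Metric.isBounded_range_of_tendsto θ hθ).exists_norm_le
  obtain ⟨N, hN⟩ := exists_nat_ge R
  have hmem (n : ℕ) : θ n ∈ Metric.closedBall (0 : Θ) N := by
    simpa using (hR _ ⟨n, rfl⟩).trans hN
  have hmem₀ : θ₀ ∈ Metric.closedBall (0 : Θ) N :=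
    Metric.isClosed_closedBall.mem_of_tendsto hθ (Eventually.of_forall hmem)
  exact hω N (fun n => ⟨θ n, hmem n⟩) ⟨θ₀, hmem₀⟩ (tendsto_subtype_rng.2 hθ)

/-! ### Growth of the integrands -/

section Growth

variable {d : ℕ} (s t x : EuclideanSpace ℝ (Fin d))

theorem norm_le_one_add_norm_pow_four : ‖x‖ ≤ (1 + ‖x‖) ^ 4 :=
  (le_add_of_nonneg_left zero_le_one).trans
    (le_self_pow₀ (le_add_of_nonneg_right (norm_nonneg x)) four_ne_zero)

theorem norm_cos_le : ‖Real.cos (inner ℝ t x)‖ ≤ (1 + ‖t‖) * (1 + ‖x‖) ^ 4 :=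
  (Real.abs_cos_le_one _).trans <| one_le_mul_of_one_le_of_one_le (by simp) (one_le_pow₀ (by simp))

theorem norm_sin_le : ‖Real.sin (inner ℝ t x)‖ ≤ (1 + ‖t‖) * (1 + ‖x‖) ^ 4 :=
  (Real.abs_sin_le_one _).trans <| one_le_mul_of_one_le_of_one_le (by simp) (one_le_pow₀ (by simp))

theorem norm_cos_smul_le : ‖Real.cos (inner ℝ t x) • x‖ ≤ (1 + ‖t‖) * (1 + ‖x‖) ^ 4 := by
  rw [norm_smul]
  calc _ ≤ 1 * ‖x‖ := by gcongr; exact Real.abs_cos_le_one _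
    _ ≤ _ := by
      gcongr
      · simp
      · exact norm_le_one_add_norm_pow_four x

theorem norm_sin_smul_le : ‖Real.sin (inner ℝ t x) • x‖ ≤ (1 + ‖t‖) * (1 + ‖x‖) ^ 4 := by
  rw [norm_smul]
  calc _ ≤ 1 * ‖x‖ := by gcongr; exact Real.abs_sin_le_one _
    _ ≤ _ := by
      gcongr
      · simp
      · exact norm_le_one_add_norm_pow_four x

theorem norm_sin_mul_sin_le : ‖Real.sin (inner ℝ s x) * Real.sin (inner ℝ t x)‖ ≤
    (1 + ‖s‖) * (1 + ‖t‖) * (1 + ‖x‖) ^ 4 := by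
  rw [norm_mul]
  calc _ ≤ (1 : ℝ) * 1 := by
        gcongr
        · exact Real.abs_sin_le_one _
        · exact Real.abs_sin_le_one _
    _ = 1 * 1 * 1 := by ring
    _ ≤ _ := by
      gcongr
      · simp
      · simp
      · exact one_le_pow₀ (by simp)

theorem norm_sin_mul_coord_le (i j : Fin d) : ‖Real.sin (inner ℝ t x) * (x i * x j)‖ ≤
    (1 + ‖t‖) * (1 + ‖x‖) ^ 4 := by
  rw [norm_mul, norm_mul]
  calc _ ≤ 1 * (‖x‖ * ‖x‖) := by
        gcongr
        · exact Real.abs_sin_le_one _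
        · exact PiLp.norm_apply_le x i
        · exact PiLp.norm_apply_le x j
    _ ≤ _ := by
      gcongr
      · simp
      · nlinarith [norm_nonneg x, pow_nonneg (norm_nonneg x) 3, pow_nonneg (norm_nonneg x) 4]

theorem norm_third_le (i j : Fin d) : ‖x i * inner ℝ t x * x j‖ ≤
    (1 + ‖t‖) * (1 + ‖x‖) ^ 4 := by
  rw [norm_mul, norm_mul]
  calc _ ≤ ‖x‖ * (‖t‖ * ‖x‖) * ‖x‖ := by
        gcongr
        · exact PiLp.norm_apply_le x i
        · exact norm_inner_le_norm t x
        · exact PiLp.norm_apply_le x j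
    _ = ‖t‖ * ‖x‖ ^ 3 := by ring
    _ ≤ _ := by
      gcongr
      · simp
      · nlinarith [norm_nonneg x, pow_nonneg (norm_nonneg x) 3, pow_nonneg (norm_nonneg x) 4]

theorem norm_fourth_le (i j : Fin d) : ‖x i * inner ℝ x s * inner ℝ t x * x j‖ ≤
    (1 + ‖s‖) * (1 + ‖t‖) * (1 + ‖x‖) ^ 4 := by
  rw [norm_mul, norm_mul, norm_mul]
  calc _ ≤ ‖x‖ * (‖x‖ * ‖s‖) * (‖t‖ * ‖x‖) * ‖x‖ := by
        gcongr
        · exact PiLp.norm_apply_le x i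
        · exact norm_inner_le_norm x s
        · exact norm_inner_le_norm t x
        · exact PiLp.norm_apply_le x j
    _ = ‖s‖ * ‖t‖ * ‖x‖ ^ 4 := by ring
    _ ≤ _ := by
      gcongr <;> simp

end Growth

/-! ### Bound on the covariance kernel -/

theorem bil_eq_sum {d : ℕ} (u : EuclideanSpace ℝ (Fin d)) (M : Matrix (Fin d) (Fin d) ℝ)
    (v : EuclideanSpace ℝ (Fin d)) : bil u M v = ∑ i, ∑ j, u i * (M i j * v j) := by
  simp only [bil, dotProduct, mulVec, Finset.mul_sum]

theorem abs_bil_le {d : ℕ} {u v : EuclideanSpace ℝ (Fin d)} {M : Matrix (Fin d) (Fin d) ℝ}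
    {b c m : ℝ} (hm0 : 0 ≤ m) (hu : ‖u‖ ≤ b) (hM : ∀ i j, |M i j| ≤ m) (hv : ‖v‖ ≤ c) :
    |bil u M v| ≤ d ^ 2 * (b * (m * c)) := by
  have hb : 0 ≤ b := (norm_nonneg _).trans hu
  rw [bil_eq_sum]
  calc |∑ i, ∑ j, u i * (M i j * v j)| ≤ ∑ i, ∑ j, |u i * (M i j * v j)| :=
        (Finset.abs_sum_le_sum_abs _ _).trans
          (Finset.sum_le_sum fun i _ => Finset.abs_sum_le_sum_abs _ _)
    _ ≤ ∑ _i : Fin d, ∑ _j : Fin d, b * (m * c) := by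
        gcongr with i _ j _
        rw [abs_mul, abs_mul]
        gcongr
        · exact (PiLp.norm_apply_le u i).trans hu
        · exact hM i j
        · exact (PiLp.norm_apply_le v j).trans hv
    _ = _ := by simp; ring

/-- Integrands of growth `c (1 + ‖x‖)⁴` have integral at most `c V`, where `V` bounds the integral of
`(1 + ‖x‖)⁴`; the measure need not be a probability measure. -/
theorem norm_integral_le_of_growth {d : ℕ} {F : Type*} [NormedAddCommGroup F] [NormedSpace ℝ F]
    {μ : Measure (EuclideanSpace ℝ (Fin d))} (hμ : Integrable (fun x => (1 + ‖x‖) ^ 4) μ)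
    {V : ℝ} (hV : ∫ x, (1 + ‖x‖) ^ 4 ∂μ ≤ V) {f : EuclideanSpace ℝ (Fin d) → F} {c : ℝ}
    (hc : 0 ≤ c) (hf : ∀ x, ‖f x‖ ≤ c * (1 + ‖x‖) ^ 4) : ‖∫ x, f x ∂μ‖ ≤ c * V := by
  refine (norm_integral_le_of_norm_le (hμ.const_mul c) (Eventually.of_forall hf)).trans ?_
  rw [integral_const_mul]
  gcongr

theorem abs_covKernel_le {d : ℕ}
    {μ : Measure (EuclideanSpace ℝ (Fin d))} (hμ : Integrable (fun x => (1 + ‖x‖) ^ 4) μ)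
    {V : ℝ} (hV1 : 1 ≤ V) (hV : ∫ x, (1 + ‖x‖) ^ 4 ∂μ ≤ V) (s t : EuclideanSpace ℝ (Fin d)) :
    |covKernel μ s t| ≤ 9 * (d ^ 2 + 1) * V ^ 3 * ((1 + ‖s‖) ^ 2 * (1 + ‖t‖) ^ 2) := by
  set p := 1 + ‖s‖ with hp
  set q := 1 + ‖t‖ with hq
  have hp1 : 1 ≤ p := by simp [hp]
  have hq1 : 1 ≤ q := by simp [hq]
  have hsp : ‖s‖ ≤ p := by simp [hp]
  have htq : ‖t‖ ≤ q := by simp [hq]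
  have hV0 : 0 ≤ V := zero_le_one.trans hV1
  have hp0 : 0 ≤ p := zero_le_one.trans hp1
  have hq0 : 0 ≤ q := zero_le_one.trans hq1
  have hRs : |reCF μ s| ≤ p * V := norm_integral_le_of_growth hμ hV hp0 (norm_cos_le s)
  have hRt : |reCF μ t| ≤ q * V := norm_integral_le_of_growth hμ hV hq0 (norm_cos_le t)
  have hIs : |imCF μ s| ≤ p * V := norm_integral_le_of_growth hμ hV hp0 (norm_sin_le s)
  have hIt : |imCF μ t| ≤ q * V := norm_integral_le_of_growth hμ hV hq0 (norm_sin_le t)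
  have hCs : ‖cosVec μ s‖ ≤ p * V := norm_integral_le_of_growth hμ hV hp0 (norm_cos_smul_le s)
  have hCt : ‖cosVec μ t‖ ≤ q * V := norm_integral_le_of_growth hμ hV hq0 (norm_cos_smul_le t)
  have hSs : ‖sinVec μ s‖ ≤ p * V := norm_integral_le_of_growth hμ hV hp0 (norm_sin_smul_le s)
  have hSt : ‖sinVec μ t‖ ≤ q * V := norm_integral_le_of_growth hμ hV hq0 (norm_sin_smul_le t)
  have hSS : |sinSin μ s t| ≤ p * q * V :=
    norm_integral_le_of_growth hμ hV (by positivity) (norm_sin_mul_sin_le s t)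
  have hMs (i j) : |sinMat μ s i j| ≤ p * V :=
    norm_integral_le_of_growth hμ hV hp0 (norm_sin_mul_coord_le s · i j)
  have hMt (i j) : |sinMat μ t i j| ≤ q * V :=
    norm_integral_le_of_growth hμ hV hq0 (norm_sin_mul_coord_le t · i j)
  have hTs (i j) : |thirdMat μ s i j| ≤ p * V :=
    norm_integral_le_of_growth hμ hV hp0 (norm_third_le s · i j)
  have hTt (i j) : |thirdMat μ t i j| ≤ q * V :=
    norm_integral_le_of_growth hμ hV hq0 (norm_third_le t · i j)
  have hF (i j) : |fourthMat μ s t i j| ≤ p * q * V :=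
    norm_integral_le_of_growth hμ hV (by positivity) (norm_fourth_le s t · i j)
  have hinner {u v : EuclideanSpace ℝ (Fin d)} {b c : ℝ} (hu : ‖u‖ ≤ b) (hv : ‖v‖ ≤ c) :
      |inner ℝ u v| ≤ b * c :=
    (abs_real_inner_le_norm u v).trans
      (mul_le_mul hu hv (norm_nonneg _) ((norm_nonneg _).trans hu))
  have hmul {u v b c : ℝ} (hu : |u| ≤ b) (hv : |v| ≤ c) : |u * v| ≤ b * c := by
    rw [abs_mul]
    exact mul_le_mul hu hv (abs_nonneg _) ((abs_nonneg _).trans hu)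
  -- Every summand of the kernel is at most `B` in absolute value, up to its coefficient.
  set B := (d ^ 2 + 1) * V ^ 3 * (p ^ 2 * q ^ 2) with hB
  have hle {D : ℝ} {i j k : ℕ} (hD : D ≤ d ^ 2 + 1) (hi : i ≤ 3) (hj : j ≤ 2) (hk : k ≤ 2) :
      D * V ^ i * (p ^ j * q ^ k) ≤ B := by
    rw [hB]
    gcongr
  have hd1 : (1 : ℝ) ≤ d ^ 2 + 1 := by simp
  have hd2 : (d : ℝ) ^ 2 ≤ d ^ 2 + 1 := by simp
  have h1 := hSS.trans
    (by linarith [hle (i := 1) (j := 1) (k := 1) hd1 (by simp) (by simp) (by simp)] : _ ≤ B)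
  have h2 := (hmul hIs hIt).trans
    (by linarith [hle (i := 2) (j := 1) (k := 1) hd1 (by simp) (by simp) (by simp)] : _ ≤ B)
  have h3 := (hmul hRt (hinner htq hSs)).trans
    (by linarith [hle (i := 2) (j := 1) (k := 2) hd1 (by simp) (by simp) (by simp)] : _ ≤ B)
  have h4 := (hmul hRs (hinner hsp hSt)).trans
    (by linarith [hle (i := 2) (j := 2) (k := 1) hd1 (by simp) (by simp) (by simp)] : _ ≤ B)
  have h5 := (hmul (hmul hRs hRt) (hinner hsp htq)).trans
    (by linarith [hle (i := 2) (j := 2) (k := 2) hd1 (by simp) (by simp) (by simp)] : _ ≤ B)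
  have h6 := (abs_bil_le (by positivity) htq hMs hCt).trans
    (by linarith [hle (i := 2) (j := 1) (k := 2) hd2 (by simp) (by simp) (by simp)] : _ ≤ B)
  have h7 := (hmul hIs (hinner htq hCt)).trans
    (by linarith [hle (i := 2) (j := 1) (k := 2) hd1 (by simp) (by simp) (by simp)] : _ ≤ B)
  have h8 := (abs_bil_le (by positivity) hsp hMt hCs).trans
    (by linarith [hle (i := 2) (j := 2) (k := 1) hd2 (by simp) (by simp) (by simp)] : _ ≤ B)
  have h9 := (hmul hIt (hinner hsp hCs)).trans
    (by linarith [hle (i := 2) (j := 2) (k := 1) hd1 (by simp) (by simp) (by simp)] : _ ≤ B)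
  have h10 := (hmul hRs (abs_bil_le (by positivity) hsp hTt hCt)).trans
    (by linarith [hle (i := 3) (j := 2) (k := 2) hd2 (by simp) (by simp) (by simp)] : _ ≤ B)
  have h11 := (hmul hRt (abs_bil_le (by positivity) htq hTs hCs)).trans
    (by linarith [hle (i := 3) (j := 2) (k := 2) hd2 (by simp) (by simp) (by simp)] : _ ≤ B)
  have h12 := (abs_bil_le (by positivity) hCs hF hCt).trans
    (by linarith [hle (i := 3) (j := 2) (k := 2) hd2 (by simp) (by simp) (by simp)] : _ ≤ B)
  have h13 := (hmul (hinner hsp hCs) (hinner htq hCt)).trans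
    (by linarith [hle (i := 2) (j := 2) (k := 2) hd1 (by simp) (by simp) (by simp)] : _ ≤ B)
  have hfin : 9 * (d ^ 2 + 1) * V ^ 3 * (p ^ 2 * q ^ 2) = 9 * B := by rw [hB]; ring
  rw [hfin, covKernel]
  rw [abs_le] at *
  constructor <;> linarith

/-! ### Measurability in the distribution and the arguments -/

/-- Parameter-dependent integrals are measurable in the parameter and in the measure, the latter
ranging over a kernel `κ`. -/
theorem measurable_integral_kernel {α β T E F : Type*} [MeasurableSpace α] [MeasurableSpace β]
    [TopologicalSpace T] [MeasurableSpace T] [BorelSpace T] [SecondCountableTopology T]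
    [TopologicalSpace E] [MeasurableSpace E] [BorelSpace E] [SecondCountableTopology E]
    [NormedAddCommGroup F] [NormedSpace ℝ F] [MeasurableSpace F] [BorelSpace F]
    [SecondCountableTopology F]
    (κ : Kernel α E) [IsSFiniteKernel κ] {h : T → E → F} (hh : Continuous (Function.uncurry h))
    {k : β → α} (hk : Measurable k) {τ : β → T} (hτ : Measurable τ) :
    Measurable fun b => ∫ x, h (τ b) x ∂(κ (k b)) := by
  have hm : StronglyMeasurable (Function.uncurry fun b x => h (τ b) x) :=
    (hh.measurable.comp ((hτ.comp measurable_fst).prodMk measurable_snd)).stronglyMeasurable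
  exact (StronglyMeasurable.integral_kernel_prod_right (κ := κ.comap k hk) hm).measurable

theorem measurable_imCF {d : ℕ} {α β : Type*} [MeasurableSpace α] [MeasurableSpace β]
    (κ : Kernel α (EuclideanSpace ℝ (Fin d))) [IsSFiniteKernel κ] {k : β → α} (hk : Measurable k)
    {s : β → EuclideanSpace ℝ (Fin d)} (hs : Measurable s) :
    Measurable fun b => imCF (κ (k b)) (s b) :=
  measurable_integral_kernel κ (h := fun t x => Real.sin (inner ℝ t x))
    (by unfold Function.uncurry; fun_prop) hk hs

theorem measurable_bil {d : ℕ} {β : Type*} [MeasurableSpace β]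
    {u v : β → EuclideanSpace ℝ (Fin d)} {M : β → Matrix (Fin d) (Fin d) ℝ} (hu : Measurable u)
    (hM : ∀ i j, Measurable fun b => M b i j) (hv : Measurable v) :
    Measurable fun b => bil (u b) (M b) (v b) := by
  simp only [bil_eq_sum]
  have hcoord {w : β → EuclideanSpace ℝ (Fin d)} (hw : Measurable w) (i : Fin d) :
      Measurable fun b => w b i :=
    (by fun_prop : Continuous fun x : EuclideanSpace ℝ (Fin d) => x i).measurable.comp hw
  exact Finset.measurable_sum _ fun i _ => Finset.measurable_sum _ fun j _ =>
    (hcoord hu i).mul ((hM i j).mul (hcoord hv j))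

/-- A constant `κ` gives measurability of the covariance kernel of a fixed distribution, and the
empirical distribution as a kernel gives measurability in the sample. -/
theorem measurable_covKernel {d : ℕ} {α β : Type*} [MeasurableSpace α] [MeasurableSpace β]
    (κ : Kernel α (EuclideanSpace ℝ (Fin d))) [IsSFiniteKernel κ] {k : β → α} (hk : Measurable k)
    {s t : β → EuclideanSpace ℝ (Fin d)} (hs : Measurable s) (ht : Measurable t) :
    Measurable fun b => covKernel (κ (k b)) (s b) (t b) := by
  have hI {r : β → EuclideanSpace ℝ (Fin d)} (hr : Measurable r) :
      Measurable fun b => imCF (κ (k b)) (r b) := measurable_imCF κ hk hr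
  have hR {r : β → EuclideanSpace ℝ (Fin d)} (hr : Measurable r) :
      Measurable fun b => reCF (κ (k b)) (r b) :=
    measurable_integral_kernel κ (h := fun t x => Real.cos (inner ℝ t x))
      (by unfold Function.uncurry; fun_prop) hk hr
  have hC {r : β → EuclideanSpace ℝ (Fin d)} (hr : Measurable r) :
      Measurable fun b => cosVec (κ (k b)) (r b) :=
    measurable_integral_kernel κ (h := fun t x => Real.cos (inner ℝ t x) • x)
      (by unfold Function.uncurry; fun_prop) hk hr
  have hS {r : β → EuclideanSpace ℝ (Fin d)} (hr : Measurable r) :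
      Measurable fun b => sinVec (κ (k b)) (r b) :=
    measurable_integral_kernel κ (h := fun t x => Real.sin (inner ℝ t x) • x)
      (by unfold Function.uncurry; fun_prop) hk hr
  have hM {r : β → EuclideanSpace ℝ (Fin d)} (hr : Measurable r) (i j : Fin d) :
      Measurable fun b => sinMat (κ (k b)) (r b) i j :=
    measurable_integral_kernel κ (h := fun t x => Real.sin (inner ℝ t x) * (x i * x j))
      (by unfold Function.uncurry; fun_prop) hk hr
  have hT {r : β → EuclideanSpace ℝ (Fin d)} (hr : Measurable r) (i j : Fin d) :
      Measurable fun b => thirdMat (κ (k b)) (r b) i j :=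
    measurable_integral_kernel κ (h := fun t x => x i * inner ℝ t x * x j)
      (by unfold Function.uncurry; fun_prop) hk hr
  have hSS : Measurable fun b => sinSin (κ (k b)) (s b) (t b) := by
    have hc : Continuous (Function.uncurry
        fun (p : EuclideanSpace ℝ (Fin d) × EuclideanSpace ℝ (Fin d))
          (x : EuclideanSpace ℝ (Fin d)) =>
            Real.sin (inner ℝ p.1 x) * Real.sin (inner ℝ p.2 x)) := by
      unfold Function.uncurry; fun_prop
    have h := measurable_integral_kernel κ hc hk (hs.prodMk ht)
    exact h
  have hF (i j : Fin d) : Measurable fun b => fourthMat (κ (k b)) (s b) (t b) i j := by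
    have hc : Continuous (Function.uncurry
        fun (p : EuclideanSpace ℝ (Fin d) × EuclideanSpace ℝ (Fin d))
          (x : EuclideanSpace ℝ (Fin d)) =>
            x i * inner ℝ x p.1 * inner ℝ p.2 x * x j) := by
      unfold Function.uncurry; fun_prop
    have h := measurable_integral_kernel κ hc hk (hs.prodMk ht)
    exact h
  have b1 := measurable_bil ht (hM hs) (hC ht)
  have b2 := measurable_bil hs (hM ht) (hC hs)
  have b3 := measurable_bil hs (hT ht) (hC ht)
  have b4 := measurable_bil ht (hT hs) (hC hs)
  have b5 := measurable_bil (hC hs) hF (hC ht)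
  have hIs := hI hs
  have hIt := hI ht
  have hRs := hR hs
  have hRt := hR ht
  have i1 := ht.inner (𝕜 := ℝ) (hS hs)
  have i2 := hs.inner (𝕜 := ℝ) (hS ht)
  have i3 := hs.inner (𝕜 := ℝ) ht
  have i4 := ht.inner (𝕜 := ℝ) (hC ht)
  have i5 := hs.inner (𝕜 := ℝ) (hC hs)
  unfold covKernel
  fun_prop

/-- The integrand of `sigmaSq` is measurable in the distribution and the arguments jointly. -/
theorem measurable_sigmaSq_integrand {d : ℕ} (a : ℝ) {α β : Type*} [MeasurableSpace α]
    [MeasurableSpace β] (κ : Kernel α (EuclideanSpace ℝ (Fin d))) [IsSFiniteKernel κ]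
    {k : β → α} (hk : Measurable k)
    {s t : β → EuclideanSpace ℝ (Fin d)} (hs : Measurable s) (ht : Measurable t) :
    Measurable fun b => covKernel (κ (k b)) (s b) (t b) * imCF (κ (k b)) (s b) *
      imCF (κ (k b)) (t b) * Real.exp (-a * (‖s b‖ ^ 2 + ‖t b‖ ^ 2)) :=
  (((measurable_covKernel κ hk hs ht).mul (measurable_imCF κ hk hs)).mul
    (measurable_imCF κ hk ht)).mul
    (((hs.norm.pow_const 2).add (ht.norm.pow_const 2)).const_mul _).exp

theorem measurable_sigmaSq_inner {d : ℕ} (a : ℝ) {α β : Type*} [MeasurableSpace α]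
    [MeasurableSpace β] (κ : Kernel α (EuclideanSpace ℝ (Fin d))) [IsSFiniteKernel κ]
    {k : β → α} (hk : Measurable k) {s : β → EuclideanSpace ℝ (Fin d)} (hs : Measurable s) :
    Measurable fun b => ∫ t, covKernel (κ (k b)) (s b) t * imCF (κ (k b)) (s b) *
      imCF (κ (k b)) t * Real.exp (-a * (‖s b‖ ^ 2 + ‖t‖ ^ 2)) :=
  (measurable_sigmaSq_integrand a κ (hk.comp measurable_fst) (hs.comp measurable_fst)
    (measurable_snd (α := β))).stronglyMeasurable.integral_prod_right'.measurable

theorem measurable_sigmaSq {d : ℕ} (a : ℝ) {α : Type*} [MeasurableSpace α]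
    (κ : Kernel α (EuclideanSpace ℝ (Fin d))) [IsSFiniteKernel κ] :
    Measurable fun k => sigmaSq a (κ k) :=
  ((measurable_sigmaSq_inner a κ measurable_fst
    (measurable_snd (α := α))).stronglyMeasurable.integral_prod_right'.measurable).const_mul 4

theorem measurable_sigmaSqHat {d n : ℕ} (a : ℝ) :
    Measurable (sigmaSqHat a : (Fin n → EuclideanSpace ℝ (Fin d)) → ℝ) := by
  have hmeas : Measurable fun x : Fin n → EuclideanSpace ℝ (Fin d) =>
      empirical (scaledResidual x) := by
    refine Measure.measurable_of_measurable_coe _ fun s hs => ?_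
    simp only [empirical, Measure.smul_apply, Measure.finsetSum_apply, smul_eq_mul]
    exact (Finset.measurable_sum _ fun j _ => (Measure.measurable_coe hs).comp
      (Measure.measurable_dirac.comp (measurable_scaledResidual j))).const_mul _
  let κ : Kernel (Fin n → EuclideanSpace ℝ (Fin d)) (EuclideanSpace ℝ (Fin d)) := ⟨_, hmeas⟩
  -- The total mass is at most `1`; it is `0` for the empty sample.
  have : IsFiniteKernel κ := by
    refine ⟨1, ENNReal.one_lt_top, fun x => ?_⟩
    simp only [κ, Kernel.coe_mk, empirical, Measure.smul_apply, Measure.finsetSum_apply,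
      smul_eq_mul, measure_univ, Finset.sum_const, Finset.card_univ, Fintype.card_fin,
      nsmul_eq_mul, mul_one]
    exact ENNReal.inv_mul_le_one _
  exact measurable_sigmaSq a κ

/-! ### Continuity of `sigmaSq` under convergence of the functionals -/

theorem integrable_one_add_norm_pow_three_mul_exp {E : Type*} [NormedAddCommGroup E]
    [InnerProductSpace ℝ E] [FiniteDimensional ℝ E] [MeasurableSpace E] [BorelSpace E]
    {a : ℝ} (ha : 0 < a) :
    Integrable fun s : E => (1 + ‖s‖) ^ 3 * Real.exp (-a * ‖s‖ ^ 2) := by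
  have hgauss : Integrable fun s : E => Real.exp (-(a / 2) * ‖s‖ ^ 2) := by
    have h := (GaussianFourier.integrable_cexp_neg_mul_sq_norm_add (V := E) (b := ((a / 2 : ℝ) : ℂ))
      (by rw [Complex.ofReal_re]; positivity) 0 0).norm
    refine h.congr (Eventually.of_forall fun s => ?_)
    simp only [Complex.norm_exp]
    congr 1
    norm_cast
    simp
  set c := a / 6 with hc
  have hc0 : 0 < c := by positivity
  refine (hgauss.const_mul ((2 + 1 / c) ^ 3)).mono' (by fun_prop) (Eventually.of_forall fun s => ?_)
  rw [Real.norm_of_nonneg (by positivity)]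
  -- A power of `1 + ‖s‖` is absorbed by half of the Gaussian exponent, a third of it per factor.
  have hu : 1 + ‖s‖ ≤ (2 + 1 / c) * Real.exp (c * ‖s‖ ^ 2) := by
    have h1 : c * ‖s‖ ^ 2 + 1 ≤ Real.exp (c * ‖s‖ ^ 2) := Real.add_one_le_exp _
    have h2 : ‖s‖ ^ 2 ≤ 1 / c * Real.exp (c * ‖s‖ ^ 2) := by
      rw [div_mul_eq_mul_div, one_mul, le_div_iff₀ hc0]
      linarith
    nlinarith [sq_nonneg (‖s‖ - 1), sq_nonneg ‖s‖]
  calc (1 + ‖s‖) ^ 3 * Real.exp (-a * ‖s‖ ^ 2)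
      ≤ ((2 + 1 / c) * Real.exp (c * ‖s‖ ^ 2)) ^ 3 * Real.exp (-a * ‖s‖ ^ 2) := by gcongr
    _ = (2 + 1 / c) ^ 3 * Real.exp (-(a / 2) * ‖s‖ ^ 2) := by
      rw [mul_pow, ← Real.exp_nat_mul, mul_assoc, ← Real.exp_add]
      congr 2
      rw [hc]
      push_cast
      ring

theorem abs_sigmaSq_integrand_le {d : ℕ} (a : ℝ)
    {μ : Measure (EuclideanSpace ℝ (Fin d))} (hμ : Integrable (fun x => (1 + ‖x‖) ^ 4) μ)
    {V : ℝ} (hV1 : 1 ≤ V) (hV : ∫ x, (1 + ‖x‖) ^ 4 ∂μ ≤ V) (s t : EuclideanSpace ℝ (Fin d)) :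
    ‖covKernel μ s t * imCF μ s * imCF μ t * Real.exp (-a * (‖s‖ ^ 2 + ‖t‖ ^ 2))‖ ≤
      9 * (d ^ 2 + 1) * V ^ 5 * ((1 + ‖s‖) ^ 3 * Real.exp (-a * ‖s‖ ^ 2)) *
        ((1 + ‖t‖) ^ 3 * Real.exp (-a * ‖t‖ ^ 2)) := by
  have hIs : |imCF μ s| ≤ (1 + ‖s‖) * V :=
    norm_integral_le_of_growth hμ hV (by positivity) (norm_sin_le s)
  have hIt : |imCF μ t| ≤ (1 + ‖t‖) * V :=
    norm_integral_le_of_growth hμ hV (by positivity) (norm_sin_le t)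
  rw [norm_mul, norm_mul, norm_mul, Real.norm_of_nonneg (Real.exp_pos _).le, mul_add, Real.exp_add]
  have hV0 : 0 ≤ V := zero_le_one.trans hV1
  calc _ ≤ 9 * (d ^ 2 + 1) * V ^ 3 * ((1 + ‖s‖) ^ 2 * (1 + ‖t‖) ^ 2) * ((1 + ‖s‖) * V) *
        ((1 + ‖t‖) * V) * (Real.exp (-a * ‖s‖ ^ 2) * Real.exp (-a * ‖t‖ ^ 2)) := by
        gcongr
        · exact abs_covKernel_le hμ hV1 hV s t
        · exact hIs
        · exact hIt
    _ = _ := by ring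

/-- Dominated convergence for `sigmaSq`: pointwise convergence of the kernel and of the imaginary
part of the characteristic function suffices, as long as fourth moments stay bounded. -/
theorem tendsto_sigmaSq {d : ℕ} {a : ℝ} (ha : 0 < a)
    {μ : ℕ → Measure (EuclideanSpace ℝ (Fin d))} [∀ n, IsFiniteMeasure (μ n)]
    {ν : Measure (EuclideanSpace ℝ (Fin d))}
    (hμ : ∀ n, Integrable (fun x => (1 + ‖x‖) ^ 4) (μ n))
    {V : ℝ} (hV : ∀ n, ∫ x, (1 + ‖x‖) ^ 4 ∂(μ n) ≤ V)
    (hK : ∀ s t, Tendsto (fun n => covKernel (μ n) s t) atTop (𝓝 (covKernel ν s t)))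
    (hI : ∀ t, Tendsto (fun n => imCF (μ n) t) atTop (𝓝 (imCF ν t))) :
    Tendsto (fun n => sigmaSq a (μ n)) atTop (𝓝 (sigmaSq a ν)) := by
  wlog hV1 : 1 ≤ V generalizing V
  · exact this (V := max V 1) (fun n => (hV n).trans (le_max_left _ _)) (le_max_right _ _)
  set w : EuclideanSpace ℝ (Fin d) → ℝ := fun s => (1 + ‖s‖) ^ 3 * Real.exp (-a * ‖s‖ ^ 2)
  have hw : Integrable w := integrable_one_add_norm_pow_three_mul_exp ha
  set D : ℝ := 9 * (d ^ 2 + 1) * V ^ 5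
  have hbound (n s t) := abs_sigmaSq_integrand_le a (hμ n) hV1 (hV n) s t
  have hmeas (n : ℕ) (s : EuclideanSpace ℝ (Fin d)) := measurable_sigmaSq_integrand a
    (Kernel.const Unit (μ n)) (measurable_const (a := ())) (measurable_const (a := s))
    (measurable_id (α := EuclideanSpace ℝ (Fin d)))
  have hmeas' (n : ℕ) := measurable_sigmaSq_inner a
    (Kernel.const Unit (μ n)) (measurable_const (a := ()))
    (measurable_id (α := EuclideanSpace ℝ (Fin d)))
  refine Tendsto.const_mul 4 ?_
  refine tendsto_integral_of_dominated_convergence (fun s => D * w s * ∫ t, w t)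
    (fun n => (hmeas' n).aestronglyMeasurable) ((hw.const_mul D).mul_const _)
    (fun n => Eventually.of_forall fun s => ?_) (Eventually.of_forall fun s => ?_)
  · rw [← integral_const_mul]
    exact norm_integral_le_of_norm_le (hw.const_mul _) (Eventually.of_forall (hbound n s))
  · exact tendsto_integral_of_dominated_convergence (fun t => D * w s * w t)
      (fun n => (hmeas n s).aestronglyMeasurable) (hw.const_mul _)
      (fun n => Eventually.of_forall (hbound n s)) (Eventually.of_forall fun t =>
        (((hK s t).mul (hI s)).mul (hI t)).mul_const _)

theorem tendsto_bil {d : ℕ} {u v : ℕ → EuclideanSpace ℝ (Fin d)}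
    {M : ℕ → Matrix (Fin d) (Fin d) ℝ} {u₀ v₀ : EuclideanSpace ℝ (Fin d)}
    {M₀ : Matrix (Fin d) (Fin d) ℝ} (hu : Tendsto u atTop (𝓝 u₀))
    (hM : ∀ i j, Tendsto (fun n => M n i j) atTop (𝓝 (M₀ i j))) (hv : Tendsto v atTop (𝓝 v₀)) :
    Tendsto (fun n => bil (u n) (M n) (v n)) atTop (𝓝 (bil u₀ M₀ v₀)) := by
  simp only [bil_eq_sum]
  have hcoord {w : ℕ → EuclideanSpace ℝ (Fin d)} {w₀ : EuclideanSpace ℝ (Fin d)}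
      (hw : Tendsto w atTop (𝓝 w₀)) (i : Fin d) : Tendsto (fun n => w n i) atTop (𝓝 (w₀ i)) :=
    ((by fun_prop : Continuous fun x : EuclideanSpace ℝ (Fin d) => x i).tendsto w₀).comp hw
  exact tendsto_finsetSum _ fun i _ => tendsto_finsetSum _ fun j _ =>
    (hcoord hu i).mul ((hM i j).mul (hcoord hv j))

theorem tendsto_covKernel {d : ℕ} {μ : ℕ → Measure (EuclideanSpace ℝ (Fin d))}
    {ν : Measure (EuclideanSpace ℝ (Fin d))}
    (hR : ∀ t, Tendsto (fun n => reCF (μ n) t) atTop (𝓝 (reCF ν t)))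
    (hI : ∀ t, Tendsto (fun n => imCF (μ n) t) atTop (𝓝 (imCF ν t)))
    (hC : ∀ t, Tendsto (fun n => cosVec (μ n) t) atTop (𝓝 (cosVec ν t)))
    (hS : ∀ t, Tendsto (fun n => sinVec (μ n) t) atTop (𝓝 (sinVec ν t)))
    (hSS : ∀ s t, Tendsto (fun n => sinSin (μ n) s t) atTop (𝓝 (sinSin ν s t)))
    (hM : ∀ i j t, Tendsto (fun n => sinMat (μ n) t i j) atTop (𝓝 (sinMat ν t i j)))
    (hT : ∀ i j t, Tendsto (fun n => thirdMat (μ n) t i j) atTop (𝓝 (thirdMat ν t i j)))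
    (hF : ∀ i j s t, Tendsto (fun n => fourthMat (μ n) s t i j) atTop (𝓝 (fourthMat ν s t i j)))
    (s t : EuclideanSpace ℝ (Fin d)) :
    Tendsto (fun n => covKernel (μ n) s t) atTop (𝓝 (covKernel ν s t)) := by
  have hinner {u v : ℕ → EuclideanSpace ℝ (Fin d)} {u₀ v₀ : EuclideanSpace ℝ (Fin d)}
      (hu : Tendsto u atTop (𝓝 u₀)) (hv : Tendsto v atTop (𝓝 v₀)) :
      Tendsto (fun n => inner ℝ (u n) (v n)) atTop (𝓝 (inner ℝ u₀ v₀)) := hu.inner hv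
  have hs : Tendsto (fun _ : ℕ => s) atTop (𝓝 s) := tendsto_const_nhds
  have ht : Tendsto (fun _ : ℕ => t) atTop (𝓝 t) := tendsto_const_nhds
  have b1 := tendsto_bil ht (hM · · s) (hC t)
  have b2 := tendsto_bil hs (hM · · t) (hC s)
  have b3 := tendsto_bil hs (hT · · t) (hC t)
  have b4 := tendsto_bil ht (hT · · s) (hC s)
  have b5 := tendsto_bil (hC s) (hF · · s t) (hC t)
  have i1 := hinner ht (hS s)
  have i2 := hinner hs (hS t)
  have i4 := hinner ht (hC t)
  have i5 := hinner hs (hC s)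
  unfold covKernel
  refine Tendsto.add ?_ ((b5.sub (i5.mul i4)).const_mul _)
  refine Tendsto.add ?_ (((hR t).const_mul _).mul b4)
  refine Tendsto.add ?_ (((hR s).const_mul _).mul b3)
  refine Tendsto.add ?_ (((hI t).const_mul _).mul i5)
  refine Tendsto.sub ?_ (b2.const_mul _)
  refine Tendsto.add ?_ (((hI s).const_mul _).mul i4)
  refine Tendsto.sub ?_ (b1.const_mul _)
  refine Tendsto.add ?_ (((hR s).mul (hR t)).mul_const _)
  refine Tendsto.sub ?_ ((hR s).mul i2)
  refine Tendsto.sub ?_ ((hR t).mul i1)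
  exact (hSS s t).sub ((hI s).mul (hI t))

/-! ### Almost sure convergence of residual averages -/

theorem integrable_one_add_norm_pow_four {d : ℕ} {ν : Measure (EuclideanSpace ℝ (Fin d))}
    [IsFiniteMeasure ν] (hmom : Integrable (fun x => ‖x‖ ^ 4) ν) :
    Integrable (fun x => (1 + ‖x‖) ^ 4) ν := by
  refine (((integrable_const (1 : ℝ)).add hmom).const_mul 8).mono' (by fun_prop)
    (Eventually.of_forall fun x => ?_)
  rw [Real.norm_of_nonneg (by positivity)]
  have := add_pow_le zero_le_one (norm_nonneg x) 4
  norm_num at this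
  simpa using this

theorem ae_tendsto_average {Ω E F : Type*} [MeasurableSpace Ω] {P : Measure Ω}
    [NormedAddCommGroup E] [MeasurableSpace E] [BorelSpace E] [SecondCountableTopology E]
    [NormedAddCommGroup F] [NormedSpace ℝ F] [CompleteSpace F] {ν : Measure E} {X : ℕ → Ω → E}
    (hlaw : ∀ j, HasLaw (X j) ν P) (hindep : iIndepFun X P)
    {f : E → F} (hf : Continuous f) (hint : Integrable f ν) :
    ∀ᵐ ω ∂P, Tendsto (fun n : ℕ => (n : ℝ)⁻¹ • ∑ j : Fin n, f (X j ω)) atTop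
      (𝓝 (∫ x, f x ∂ν)) := by
  have := ae_tendsto_average_param_of_compact (Θ := Unit) hlaw hindep (g := fun _ x => f x)
    (hf.comp continuous_snd) hint.norm (fun _ _ => le_rfl)
  filter_upwards [this] with ω hω
  refine (hω (fun _ => ()) () tendsto_const_nhds).congr fun n => ?_
  rw [Finset.sum_range]

section Residuals

variable {d : ℕ} {Ω : Type*} [MeasurableSpace Ω] {P : Measure Ω}
  {ν : Measure (EuclideanSpace ℝ (Fin d))} {X : ℕ → Ω → EuclideanSpace ℝ (Fin d)}

theorem ae_tendsto_sampleMean (hlaw : ∀ j, HasLaw (X j) ν P) (hindep : iIndepFun X P)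
    (hmom : Integrable (fun x => (1 + ‖x‖) ^ 4) ν) (hmean : ∫ x, x ∂ν = 0) :
    ∀ᵐ ω ∂P, Tendsto (fun n : ℕ => sampleMean fun j : Fin n => X j ω) atTop (𝓝 0) := by
  have hint : Integrable (fun x => x) ν := hmom.mono' (by fun_prop)
    (Eventually.of_forall norm_le_one_add_norm_pow_four)
  have h := ae_tendsto_average hlaw hindep continuous_id hint
  simp only [id, hmean] at h
  exact h

theorem ae_tendsto_sampleCov (hlaw : ∀ j, HasLaw (X j) ν P) (hindep : iIndepFun X P)
    (hmom : Integrable (fun x => (1 + ‖x‖) ^ 4) ν) (hmean : ∫ x, x ∂ν = 0)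
    (hcov : ∀ i j : Fin d, ∫ x, x i * x j ∂ν = if i = j then 1 else 0) :
    ∀ᵐ ω ∂P, Tendsto (fun n : ℕ => sampleCov fun j : Fin n => X j ω) atTop (𝓝 1) := by
  have h2 (i j : Fin d) : ∀ᵐ ω ∂P,
      Tendsto (fun n : ℕ => (n : ℝ)⁻¹ • ∑ k : Fin n, X k ω i * X k ω j) atTop
        (𝓝 (∫ x, x i * x j ∂ν)) := by
    refine ae_tendsto_average hlaw hindep (f := fun x => x i * x j) (by fun_prop) ?_
    refine hmom.mono' (by fun_prop) (Eventually.of_forall fun x => ?_)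
    calc ‖x i * x j‖ ≤ ‖x‖ * ‖x‖ := by
          rw [norm_mul]
          gcongr
          · exact PiLp.norm_apply_le x i
          · exact PiLp.norm_apply_le x j
      _ ≤ (1 + ‖x‖) ^ 4 := by
          nlinarith [norm_nonneg x, pow_nonneg (norm_nonneg x) 3, pow_nonneg (norm_nonneg x) 4]
  filter_upwards [ae_all_iff.2 fun i => ae_all_iff.2 (h2 i),
    ae_tendsto_sampleMean hlaw hindep hmom hmean] with ω hω hm
  have hmi (i : Fin d) : Tendsto (fun n : ℕ => sampleMean (fun j : Fin n => X j ω) i) atTop (𝓝 0) :=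
    ((by fun_prop : Continuous fun x : EuclideanSpace ℝ (Fin d) => x i).tendsto 0).comp hm
  refine tendsto_pi_nhds.2 fun i => tendsto_pi_nhds.2 fun j => ?_
  have := (hω i j).sub ((hmi i).mul (hmi j))
  simp only [sampleCov_apply]
  simpa [hcov, Matrix.one_apply] using this

open scoped MatrixOrder in
/-- The residuals are the images of the data under affine maps converging to the identity, and the
coefficients of the affine map are regarded as additional parameters in the uniform law of large
numbers. -/
theorem ae_tendsto_integral_empirical_scaledResidual {T F : Type*} [NormedAddCommGroup T]
    [ProperSpace T] [NormedAddCommGroup F] [NormedSpace ℝ F] [CompleteSpace F]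
    (hlaw : ∀ j, HasLaw (X j) ν P) (hindep : iIndepFun X P)
    (hmom : Integrable (fun x => (1 + ‖x‖) ^ 4) ν) (hmean : ∫ x, x ∂ν = 0)
    (hcov : ∀ i j : Fin d, ∫ x, x i * x j ∂ν = if i = j then 1 else 0)
    {h : T → EuclideanSpace ℝ (Fin d) → F} (hh : Continuous (Function.uncurry h))
    (hgrowth : ∀ p y, ‖h p y‖ ≤ (1 + ‖p‖) ^ 2 * (1 + ‖y‖) ^ 4) :
    ∀ᵐ ω ∂P, ∀ p : T, Tendsto
      (fun n : ℕ => ∫ y, h p y ∂(empirical (scaledResidual fun j : Fin n => X j ω))) atTop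
      (𝓝 (∫ y, h p y ∂ν)) := by
  let E := EuclideanSpace ℝ (Fin d)
  let g : T × (E →L[ℝ] E) × E → E → F := fun θ x => h θ.1 (θ.2.1 (x - θ.2.2))
  have hg : Continuous (Function.uncurry g) := by
    have : Continuous fun q : (T × (E →L[ℝ] E) × E) × E => (q.1.1, q.1.2.1 (q.2 - q.1.2.2)) := by
      fun_prop
    exact hh.comp this
  have hgb (N : ℕ) (θ : T × (E →L[ℝ] E) × E) (x : E) (hθ : ‖θ‖ ≤ N) :
      ‖g θ x‖ ≤ (1 + N) ^ 10 * (1 + ‖x‖) ^ 4 := by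
    have h1 : ‖θ.1‖ ≤ N := (norm_fst_le θ).trans hθ
    have h2 : ‖θ.2.1‖ ≤ N := (norm_fst_le _).trans ((norm_snd_le θ).trans hθ)
    have h3 : ‖θ.2.2‖ ≤ N := (norm_snd_le _).trans ((norm_snd_le θ).trans hθ)
    have hN : (0 : ℝ) ≤ N := N.cast_nonneg
    have h4 : ‖θ.2.1 (x - θ.2.2)‖ ≤ N * (‖x‖ + N) :=
      (θ.2.1.le_opNorm _).trans <| mul_le_mul h2
        ((norm_sub_le _ _).trans (add_le_add_right h3 _)) (norm_nonneg _) hN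
    have h5 : 1 + ‖θ.2.1 (x - θ.2.2)‖ ≤ (1 + N) ^ 2 * (1 + ‖x‖) := by
      nlinarith [norm_nonneg x, mul_nonneg hN (norm_nonneg x),
        mul_nonneg (mul_nonneg hN hN) (norm_nonneg x)]
    calc ‖g θ x‖ ≤ (1 + ‖θ.1‖) ^ 2 * (1 + ‖θ.2.1 (x - θ.2.2)‖) ^ 4 := hgrowth _ _
      _ ≤ (1 + N) ^ 2 * ((1 + N) ^ 2 * (1 + ‖x‖)) ^ 4 := by gcongr
      _ = _ := by ring
  have hulln := ae_tendsto_average_param hlaw hindep hg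
    (b := fun N x => (1 + (N : ℝ)) ^ 10 * (1 + ‖x‖) ^ 4) (fun N => hmom.const_mul _) hgb
  filter_upwards [hulln, ae_tendsto_sampleMean hlaw hindep hmom hmean,
    ae_tendsto_sampleCov hlaw hindep hmom hmean hcov] with ω hω hm hS p
  have hA := tendsto_sqrt_inv (fun n => posSemidef_sampleCov fun j : Fin n => X j ω) hS
  have hB : Tendsto (fun n : ℕ => toEuclideanCLM (𝕜 := ℝ)
      (CFC.sqrt (sampleCov fun j : Fin n => X j ω)⁻¹)) atTop (𝓝 1) := by
    have hcont : Continuous (toEuclideanCLM (𝕜 := ℝ) (n := Fin d)) :=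
      LinearMap.continuous_of_finiteDimensional
        (toEuclideanCLM (𝕜 := ℝ) (n := Fin d)).toAlgEquiv.toLinearMap
    have := (hcont.tendsto 1).comp hA
    rw [map_one] at this
    exact this
  have hlim := hω _ _ ((tendsto_const_nhds (x := p)).prodMk_nhds (hB.prodMk_nhds hm))
  have hval : ∫ x, g (p, 1, 0) x ∂ν = ∫ y, h p y ∂ν := by simp [g]
  rw [hval] at hlim
  refine hlim.congr fun n => ?_
  rw [integral_empirical, Finset.sum_range]
  rfl

theorem integrable_empirical {n : ℕ} (y : Fin n → EuclideanSpace ℝ (Fin d))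
    (f : EuclideanSpace ℝ (Fin d) → ℝ) : Integrable f (empirical y) := by
  rcases eq_or_ne n 0 with rfl | hn
  · simp [empirical]
  · refine Integrable.smul_measure ?_ (by simpa using hn)
    exact integrable_finsetSum_measure.2 fun j _ => integrable_dirac (by simp)

instance isFiniteMeasure_empirical {n : ℕ} (y : Fin n → EuclideanSpace ℝ (Fin d)) :
    IsFiniteMeasure (empirical y) :=
  (integrable_const_iff_isFiniteMeasure one_ne_zero).1 (integrable_empirical y fun _ => 1)

/-- Strong consistency of the estimator. -/
theorem ae_tendsto_sigmaSqHat {a : ℝ} (ha : 0 < a)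
    (hlaw : ∀ j, HasLaw (X j) ν P) (hindep : iIndepFun X P)
    (hmom : Integrable (fun x => (1 + ‖x‖) ^ 4) ν) (hmean : ∫ x, x ∂ν = 0)
    (hcov : ∀ i j : Fin d, ∫ x, x i * x j ∂ν = if i = j then 1 else 0) :
    ∀ᵐ ω ∂P, Tendsto (fun n : ℕ => sigmaSqHat a fun j : Fin n => X j ω) atTop
      (𝓝 (sigmaSq a ν)) := by
  -- Every functional depends continuously on one argument or on the pair of both.
  have one {F : Type} [NormedAddCommGroup F] [NormedSpace ℝ F] [CompleteSpace F]
      (h : EuclideanSpace ℝ (Fin d) → EuclideanSpace ℝ (Fin d) → F)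
      (hh : Continuous (Function.uncurry h))
      (hgrowth : ∀ t y, ‖h t y‖ ≤ (1 + ‖t‖) * (1 + ‖y‖) ^ 4) :=
    ae_tendsto_integral_empirical_scaledResidual hlaw hindep hmom hmean hcov hh
      fun p y => (hgrowth p y).trans (by gcongr; exact le_self_pow₀ (by simp) two_ne_zero)
  have two (h : EuclideanSpace ℝ (Fin d) × EuclideanSpace ℝ (Fin d) →
        EuclideanSpace ℝ (Fin d) → ℝ)
      (hh : Continuous (Function.uncurry h))
      (hgrowth : ∀ p y, ‖h p y‖ ≤ (1 + ‖p.1‖) * (1 + ‖p.2‖) * (1 + ‖y‖) ^ 4) :=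
    ae_tendsto_integral_empirical_scaledResidual hlaw hindep hmom hmean hcov hh
      fun p y => (hgrowth p y).trans (by
        rw [sq]
        gcongr
        · exact norm_fst_le p
        · exact norm_snd_le p)
  have hW := one (fun _ y => (1 + ‖y‖) ^ 4) (by unfold Function.uncurry; fun_prop) fun t y => by
    rw [Real.norm_of_nonneg (by positivity)]
    exact le_mul_of_one_le_left (by positivity) (by simp)
  have hR := one (fun t y => Real.cos (inner ℝ t y)) (by unfold Function.uncurry; fun_prop)
    norm_cos_le
  have hI := one (fun t y => Real.sin (inner ℝ t y)) (by unfold Function.uncurry; fun_prop)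
    norm_sin_le
  have hC := one (fun t y => Real.cos (inner ℝ t y) • y) (by unfold Function.uncurry; fun_prop)
    norm_cos_smul_le
  have hS := one (fun t y => Real.sin (inner ℝ t y) • y) (by unfold Function.uncurry; fun_prop)
    norm_sin_smul_le
  have hM (i j : Fin d) := one (fun t y => Real.sin (inner ℝ t y) * (y i * y j))
    (by unfold Function.uncurry; fun_prop) (norm_sin_mul_coord_le · · i j)
  have hT (i j : Fin d) := one (fun t y => y i * inner ℝ t y * y j)
    (by unfold Function.uncurry; fun_prop) (norm_third_le · · i j)
  have hSS := two (fun p y => Real.sin (inner ℝ p.1 y) * Real.sin (inner ℝ p.2 y))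
    (by unfold Function.uncurry; fun_prop) fun p y => norm_sin_mul_sin_le p.1 p.2 y
  have hF (i j : Fin d) := two (fun p y => y i * inner ℝ y p.1 * inner ℝ p.2 y * y j)
    (by unfold Function.uncurry; fun_prop) fun p y => norm_fourth_le p.1 p.2 y i j
  filter_upwards [hW, hR, hI, hC, hS, hSS, ae_all_iff.2 fun i => ae_all_iff.2 (hM i),
    ae_all_iff.2 fun i => ae_all_iff.2 (hT i), ae_all_iff.2 fun i => ae_all_iff.2 (hF i)]
    with ω hW hR hI hC hS hSS hM hT hF
  -- The integrand of `hW` does not depend on its parameter, which is set to `0`.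
  obtain ⟨V, hV⟩ := (hW 0).bddAbove_range
  exact tendsto_sigmaSq ha (fun n => integrable_empirical _ _) (fun n => hV ⟨n, rfl⟩)
    (tendsto_covKernel hR hI hC hS (fun s t => hSS (s, t)) hM hT fun i j s t => hF i j (s, t)) hI

end Residuals

end ReflectedSymmetry

open ReflectedSymmetry in
theorem theorem4 {d : ℕ} (hd : 1 ≤ d) {a : ℝ} (ha : 0 < a)
    {Ω : Type*} [MeasurableSpace Ω] (P : Measure Ω) [IsProbabilityMeasure P]
    (ν : Measure (EuclideanSpace ℝ (Fin d))) [IsProbabilityMeasure ν]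
    (X : ℕ → Ω → EuclideanSpace ℝ (Fin d))
    (hlaw : ∀ j, HasLaw (X j) ν P) (hindep : iIndepFun X P)
    (hac : ν ≪ volume)
    (hmom : Integrable (fun x => ‖x‖ ^ 4) ν)
    (hmean : ∫ x, x ∂ν = 0)
    (hcov : ∀ i j : Fin d, ∫ x, x i * x j ∂ν = if i = j then 1 else 0)
    (hasym : ¬ ReflectedSymmetry.IsReflectedSymmetric ν) :
    TendstoInMeasure P
      (fun (n : ℕ) ω => ReflectedSymmetry.sigmaSqHat a (fun j : Fin n => X j ω)) atTop
      (fun _ => ReflectedSymmetry.sigmaSq a ν) := by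
  refine tendstoInMeasure_of_tendsto_ae (fun n => ?_)
    (ae_tendsto_sigmaSqHat ha hlaw hindep (integrable_one_add_norm_pow_four hmom) hmean hcov)
  exact ((measurable_sigmaSqHat a).comp_aemeasurable
    (aemeasurable_pi_lambda _ fun j : Fin n => (hlaw j).aemeasurable)).aestronglyMeasurable
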